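/- Let $\Sigma$ be a relational first-order language whose predicate symbols have positive arity; a theory in $\Sigma$ is a theory $\mathrm{Th}(\mathcal A)$ of a nonempty $\Sigma$-structure $\mathcal A$. For nonempty $\Sigma$-structures $\mathcal A_i$ ($i\in I$), let $\mathrm{Comb}_E(\mathcal A_i)_{i\in I}$ be the disjoint union of the $\mathcal A_i$ (a predicate of $\Sigma$ holds of a tuple iff the tuple lies in a single $\mathcal A_i$ and the predicate holds of it there), expanded by a new binary symbol $E$ interpreted as the equivalence relation whose classes are the universes of the $\mathcal A_i$. For a set $\mathcal T$ of theories in $\Sigma$, let $\mathrm{Cl}_E(\mathcal T)$ be the set of all $\mathrm{Th}(\mathcal B{\upharpoonright}C)$, where $C$ is an $E$-class of a structure $\mathcal B\equiv\mathrm{Comb}_E(\mathcal A_i)_{i\in I}$ with $\mathrm{Th}(\mathcal A_i)\in\mathcal T$ for all $i\in I$, and $\mathcal B{\upharpoonright}C$ is regarded as a $\Sigma$-structure. The set $\mathcal T$ is $E$-closed if $\mathrm{Cl}_E(\mathcal T)=\mathcal T$. For an $E$-closed $\mathcal T$, a subset $\mathcal S\subseteq\mathcal T$ is generating if $\mathrm{Cl}_E(\mathcal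 S)=\mathcal T$; it is minimal generating if moreover no proper subset of $\mathcal S$ is generating; and it is the least generating set if it is minimal generating and contained in every generating set for $\mathcal T$. **Proposition 3.7.** Let $\mathcal T_0$ be a set of theories in $\Sigma$ such that infinitely many predicate symbols $R$ of $\Sigma$ are empty for all theories in $\mathcal T_0$ (that is, $\forall\bar x\,\neg R(\bar x)\in T$ for every $T\in\mathcal T_0$). Then there is an $E$-closed set $\mathcal T_0'\supseteq\mathcal T_0$ of theories in the same language $\Sigma$ that does not have a least generating set. -/

import Mathlib

universe u v w w'

namespace EClosure

/-- The single symbol of the language of one equivalence relation: a binary predicate symbol `E`. -/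
inductive EqvSymbol : ℕ → Type
  | E : EqvSymbol 2

/-- The language `{E}` with one binary predicate symbol. -/
def eqvLanguage : FirstOrder.Language.{0, 0} := ⟨fun _ => Empty, EqvSymbol⟩

/-- The underlying set of the `E`-union of the structures `A i`: their disjoint union. -/
def EComb {I : Type w} (A : I → Type w') : Type (max w w') := Σ i, A i

/-- The predicates of the `E`-union: `R` holds of a tuple exactly when the tuple lies in a single
`A i` and `R` holds of it there. (The language is relational, so there is nothing to say about
function symbols.) -/
instance ECombStructure {L : FirstOrder.Language.{u, v}} [L.IsRelational] {I : Type w} (A : I → Type w')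
    [∀ i, L.Structure (A i)] : L.Structure (EComb A) where
  funMap f := isEmptyElim f
  RelMap {n} R x := ∃ (i : I) (y : Fin n → A i), (∀ k, x k = ⟨i, y k⟩) ∧
    FirstOrder.Language.Structure.RelMap R y

/-- In the `E`-union the symbol `E` is interpreted as the equivalence relation whose classes are
the sets `A i`. -/
instance ECombEqvStructure {I : Type w} (A : I → Type w') : eqvLanguage.Structure (EComb A) where
  funMap f := f.elim
  RelMap {n} R := match n, R with
    | _, EqvSymbol.E => fun x => (x 0).1 = (x 1).1

/-- The `E`-class of `b`, as a substructure for the relational language `L` (the symbol `E` is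
forgotten; in a relational language every subset carries a substructure). -/
def eClass (L : FirstOrder.Language.{u, v}) [L.IsRelational] {B : Type w} [L.Structure B]
    [eqvLanguage.Structure B] (b : B) : L.Substructure B where
  carrier := {c | FirstOrder.Language.Structure.RelMap (L := eqvLanguage) EqvSymbol.E ![b, c]}
  fun_mem f := isEmptyElim f

/-- The `E`-closure `Cl_E(𝒯)` of a set `𝒯` of theories in the relational language `L`:
all theories `Th(C)`, where `C` is (the `L`-structure on) some `E`-class of some structure
`B ≡ Comb_E(A i)_{i ∈ I}`, with `Th(A i) ∈ 𝒯` for all `i ∈ I`. -/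
def ClE {L : FirstOrder.Language.{u, v}} [L.IsRelational] (𝒯 : Set L.Theory) : Set L.Theory :=
  {T | ∃ (I : Type (max u v)) (A : I → Type (max u v)) (_ : ∀ i, L.Structure (A i))
      (B : Type (max u v)) (_ : L.Structure B) (_ : eqvLanguage.Structure B),
      (∀ i, Nonempty (A i)) ∧
      (∀ i, L.completeTheory (A i) ∈ 𝒯) ∧
      (L.sum eqvLanguage).ElementarilyEquivalent B (EComb A) ∧
      ∃ b : B, T = L.completeTheory (eClass L b)}

/-- `𝒯` is `E`-closed. -/
def IsEClosed {L : FirstOrder.Language.{u, v}} [L.IsRelational] (𝒯 : Set L.Theory) : Prop :=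
  ClE 𝒯 = 𝒯

/-- `𝒮` is a generating set for the (`E`-closed) set `𝒯`. -/
def IsGenerating {L : FirstOrder.Language.{u, v}} [L.IsRelational] (𝒮 𝒯 : Set L.Theory) : Prop :=
  𝒮 ⊆ 𝒯 ∧ ClE 𝒮 = 𝒯

/-- `𝒮` is a minimal generating set for `𝒯`: it contains no proper generating subset. -/
def IsMinimalGenerating {L : FirstOrder.Language.{u, v}} [L.IsRelational] (𝒮 𝒯 : Set L.Theory) : Prop :=
  IsGenerating 𝒮 𝒯 ∧ ∀ 𝒮' : Set L.Theory, 𝒮' ⊂ 𝒮 → ¬ IsGenerating 𝒮' 𝒯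

/-- `𝒮` is the least generating set for `𝒯`: a minimal generating set contained in every
generating set. -/
def IsLeastGenerating {L : FirstOrder.Language.{u, v}} [L.IsRelational] (𝒮 𝒯 : Set L.Theory) : Prop :=
  IsMinimalGenerating 𝒮 𝒯 ∧ ∀ 𝒮' : Set L.Theory, IsGenerating 𝒮' 𝒯 → 𝒮 ⊆ 𝒮'

/-- A family of complete (deductively closed, satisfiable) theories in the language `L`. -/
def IsFamily {L : FirstOrder.Language.{u, v}} (𝒯 : Set L.Theory) : Prop :=
  ∀ T ∈ 𝒯, T.IsMaximal

/-- The sentence `∀ x₁ … xₙ, ¬ R(x₁, …, xₙ)`, saying that the predicate `R` is empty. -/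
def emptySentence {L : FirstOrder.Language.{u, v}} {n : ℕ} (R : L.Relations n) : L.Sentence :=
  (R.boundedFormula fun i : Fin n => (FirstOrder.Language.Term.var (Sum.inr i) :
    L.Term (Empty ⊕ Fin n))).not.alls

end EClosure

/-! On families of complete theories, `ClE` is closure in the topology with basic open sets `{T | φ
∈ T}` (`clE_eq_theoryClosure`): relativizing to an `E`-class gives one inclusion, compactness the
other. So generating means dense. Deleting a non-isolated point keeps a set generating, hence a
least generating set could contain only isolated points; yet, being dense, it meets every nonempty
open set. It cannot exist once some nonempty relatively open set has no isolated point
(`not_exists_isLeastGenerating`).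

To create such an open set, let `P` be the infinite set of predicates empty throughout `𝒯₀`. Add the
theories of all one-point structures whose nonempty predicates lie in `P`, and take the closure. A
sentence mentions finitely many predicates, so these points form a Cantor-like cube without isolated
points (`exists_pointTheory_ne`). For `R ∈ P`, the open condition "`R` is nonempty" excludes `𝒯₀`.
-/

namespace EClosure

open FirstOrder FirstOrder.Language

/-! ### Relativization to an `E`-class -/

section Relativization

variable {L : FirstOrder.Language.{u, v}}

/-- The term `t`, with its variables renamed, in the language expanded by `E`. -/
def relTerm {n : ℕ} (t : L.Term (Empty ⊕ Fin n)) : (L.sum eqvLanguage).Term (Unit ⊕ Fin n) :=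
  (LHom.sumInl.onTerm t).relabel (Sum.map Empty.elim id)

/-- The formula `E(x, y)`, with `x` the free variable and `y` the last bound one. -/
def eqvFormula (L : FirstOrder.Language.{u, v}) (n : ℕ) :
    (L.sum eqvLanguage).BoundedFormula Unit (n + 1) :=
  .rel (Sum.inr EqvSymbol.E : (L.sum eqvLanguage).Relations 2)
    ![.var (.inl ()), .var (.inr (Fin.last n))]

/-- The relativization of a formula to the `E`-class of the free variable. -/
def relativize : ∀ {n : ℕ}, L.BoundedFormula Empty n → (L.sum eqvLanguage).BoundedFormula Unit n
  | _, .falsum => .falsum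
  | _, .equal t₁ t₂ => .equal (relTerm t₁) (relTerm t₂)
  | _, .rel R ts => .rel (Sum.inl R : (L.sum eqvLanguage).Relations _) fun i => relTerm (ts i)
  | _, .imp φ ψ => .imp (relativize φ) (relativize ψ)
  | n, .all φ => .all (.imp (eqvFormula L n) (relativize φ))

variable {B : Type w} [L.Structure B] [eqvLanguage.Structure B]

theorem realize_eqvFormula (b : B) {n : ℕ} (xs : Fin (n + 1) → B) :
    (eqvFormula L n).Realize (fun _ => b) xs ↔
      FirstOrder.Language.Structure.RelMap (L := eqvLanguage) EqvSymbol.E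
        ![b, xs (Fin.last n)] := by
  refine iff_of_eq (congrArg (FirstOrder.Language.Structure.RelMap (L := eqvLanguage)
    EqvSymbol.E) ?_)
  funext i
  fin_cases i <;> rfl

variable [L.IsRelational]

theorem realize_relTerm (b : B) {n : ℕ} (t : L.Term (Empty ⊕ Fin n)) (xs : Fin n → eClass L b) :
    (relTerm t).realize (Sum.elim (fun _ => b) fun i => (xs i : B)) =
      (t.realize (Sum.elim (fun x => x.elim) xs) : eClass L b) := by
  rcases t with (x | i) | f
  · exact x.elim
  · rfl
  · exact isEmptyElim f

theorem realize_relativize (b : B) {n : ℕ} (φ : L.BoundedFormula Empty n)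
    (xs : Fin n → eClass L b) :
    (relativize φ).Realize (fun _ => b) (fun i => (xs i : B)) ↔
      φ.Realize (fun x => x.elim) xs := by
  induction φ with
  | falsum => rfl
  | equal t₁ t₂ =>
    simp only [relativize, BoundedFormula.Realize, realize_relTerm]
    exact Subtype.ext_iff.symm
  | rel R ts =>
    simp only [relativize, BoundedFormula.Realize, realize_relTerm]
    rfl
  | imp φ ψ ihφ ihψ => simp only [relativize, BoundedFormula.Realize, ihφ, ihψ]
  | all φ ih =>
    simp only [relativize, BoundedFormula.Realize, realize_eqvFormula, Fin.snoc_last]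
    have key : ∀ x : eClass L b, (Fin.snoc (fun i => (xs i : B)) (x : B) : Fin _ → B) =
        fun i => ((Fin.snoc xs x : Fin _ → eClass L b) i : B) := fun x => by
      funext i
      refine Fin.lastCases ?_ (fun j => ?_) i <;> simp
    constructor
    · intro h x
      rw [← ih, ← key]
      exact h x x.2
    · intro h x hx
      rw [key ⟨x, hx⟩, ih]
      exact h ⟨x, hx⟩

theorem realize_relativize_sentence (b : B) (φ : L.Sentence) :
    Formula.Realize (relativize φ) (fun _ => b) ↔ eClass L b ⊨ φ := by
  have h := realize_relativize b φ default
  rw [Subsingleton.elim (fun i => ((default : Fin 0 → eClass L b) i : B)) default,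
    Subsingleton.elim (fun x : Empty => (x.elim : eClass L b)) default] at h
  exact h

end Relativization

/-! ### Elementary equivalence and realization of formulas in one variable -/

section Realization

variable {L : FirstOrder.Language.{u, v}}

/-- The sentence `∃ x, φ(x)`. -/
noncomputable def exSentence (φ : L.Formula Unit) : L.Sentence :=
  Formula.iExs Unit (φ.relabel (Sum.inr : Unit → Empty ⊕ Unit))

theorem realize_exSentence {M : Type w} [L.Structure M] (φ : L.Formula Unit) :
    M ⊨ exSentence φ ↔ ∃ b : M, φ.Realize fun _ => b := by
  rw [exSentence, Sentence.Realize, Formula.realize_iExs]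
  simp only [Formula.realize_relabel]
  exact ⟨fun ⟨i, h⟩ => ⟨i (), h⟩, fun ⟨b, h⟩ => ⟨fun _ => b, h⟩⟩

/-- Compactness: replace the free variable by a new constant and add the complete theory of `M`;
each finite part holds in `M` with the constant suitably interpreted. -/
theorem exists_elementarilyEquivalent_realize {M : Type w} [L.Structure M]
    {Γ : Set (L.Formula Unit)}
    (hΓ : ∀ s : Finset (L.Formula Unit), (s : Set (L.Formula Unit)) ⊆ Γ →
      ∃ b : M, ∀ φ ∈ s, φ.Realize fun _ => b) :
    ∃ (N : Type (max u v)) (_ : L.Structure N),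
      L.ElementarilyEquivalent N M ∧ ∃ b : N, ∀ φ ∈ Γ, φ.Realize fun _ => b := by
  classical
  let T : (L[[Unit]]).Theory :=
    (L.lhomWithConstants Unit).onTheory (L.completeTheory M) ∪ Formula.equivSentence '' Γ
  have hT : T.IsSatisfiable := by
    rw [Theory.isSatisfiable_iff_isFinitelySatisfiable]
    intro T₀ hT₀
    obtain ⟨b, hb⟩ := hΓ ((T₀.image Formula.equivSentence.symm).filter (· ∈ Γ))
      (fun φ hφ => (Finset.mem_filter.1 hφ).2)
    let := constantsOn.structure (fun _ : Unit => b)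
    have : Nonempty M := ⟨b⟩
    suffices h : M ⊨ (T₀ : (L[[Unit]]).Theory) from Theory.Model.isSatisfiable M
    refine ⟨fun φ hφ => ?_⟩
    rcases hT₀ hφ with h | ⟨ψ, hψ, rfl⟩
    · exact (((L.lhomWithConstants Unit).onTheory_model _).2
        (model_completeTheory (L := L) (M := M))).realize_of_mem φ h
    · rw [Formula.realize_equivSentence]
      refine hb ψ (Finset.mem_filter.2 ⟨Finset.mem_image.2 ⟨_, hφ, ?_⟩, hψ⟩)
      simp
  obtain ⟨N⟩ := hT
  let : L.Structure N := (L.lhomWithConstants Unit).reduct N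
  have : (L.lhomWithConstants Unit).IsExpansionOn N := LHom.isExpansionOn_reduct _ _
  have hN : N ⊨ L.completeTheory M := ((L.lhomWithConstants Unit).onTheory_model _).1
    (Theory.Model.mono N.is_model Set.subset_union_left)
  refine ⟨N, inferInstance, ?_, (L.con () : N), fun φ hφ => ?_⟩
  · rw [elementarilyEquivalent_iff]
    exact realize_iff_of_model_completeTheory M N
  · rw [← Formula.realize_equivSentence]
    exact T.realize_sentence_of_mem (Or.inr ⟨φ, hφ, rfl⟩)

/-- Compactness yields one structure for the sum language, whereas `ClE` asks for two separate ones;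
splitting and recombining loses nothing. -/
theorem sumStructure_reduct {L' : FirstOrder.Language.{0, 0}} {B : Type w}
    (S : (L.sum L').Structure B) :
    @Language.sumStructure L L' B ((LHom.sumInl : L →ᴸ L.sum L').reduct B)
      ((LHom.sumInr : L' →ᴸ L.sum L').reduct B) = S := by
  ext n f x
  · rcases f with f | f <;> rfl
  · rcases f with f | f <;> rfl

end Realization

/-! ### Maximal theories -/

section Maximal

variable {L : FirstOrder.Language.{u, v}}

theorem eq_of_isMaximal_of_subset {T T' : L.Theory} (hT : T.IsMaximal) (hT' : T'.IsMaximal)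
    (h : T ⊆ T') : T = T' := by
  refine h.antisymm fun φ hφ => (hT.mem_or_not_mem φ).resolve_right fun hn => ?_
  obtain ⟨M⟩ := hT'.1
  exact (Sentence.realize_not M).1 (T'.realize_sentence_of_mem (h hn))
    (T'.realize_sentence_of_mem hφ)

theorem not_mem_iff_of_isMaximal {T : L.Theory} (hT : T.IsMaximal) (φ : L.Sentence) :
    Formula.not φ ∈ T ↔ φ ∉ T := by
  refine ⟨fun hn hφ => ?_, (hT.mem_or_not_mem φ).resolve_left⟩
  obtain ⟨M⟩ := hT.1
  exact (Sentence.realize_not M).1 (T.realize_sentence_of_mem hn) (T.realize_sentence_of_mem hφ)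

theorem inf_mem_iff_of_isMaximal {T : L.Theory} (hT : T.IsMaximal) (φ ψ : L.Sentence) :
    φ ⊓ ψ ∈ T ↔ φ ∈ T ∧ ψ ∈ T := by
  obtain ⟨M⟩ := hT.1
  have h : ∀ χ : L.Sentence, χ ∈ T ↔ M ⊨ χ := fun χ =>
    ⟨T.realize_sentence_of_mem, fun hχ => by
      by_contra hc
      exact (Sentence.realize_not M).1
        (T.realize_sentence_of_mem ((not_mem_iff_of_isMaximal hT χ).2 hc)) hχ⟩
  rw [h, h, h]
  exact Formula.realize_inf

/-- A conjunction replaces the finite set, so that closure conditions about single sentences apply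
to it. -/
theorem exists_mem_forall_subset {T : L.Theory} (hT : T.IsMaximal) (s : Finset L.Sentence)
    (hs : (s : Set L.Sentence) ⊆ T) :
    ∃ ψ ∈ T, ∀ T' : L.Theory, T'.IsMaximal → ψ ∈ T' → (s : Set L.Sentence) ⊆ T' := by
  classical
  induction s using Finset.induction_on with
  | empty => exact ⟨⊤, hT.mem_of_models fun _ _ _ => by simp, by simp⟩
  | insert φ s _ ih =>
    rw [Finset.coe_insert, Set.insert_subset_iff] at hs
    obtain ⟨ψ, hψ, h⟩ := ih hs.2
    refine ⟨φ ⊓ ψ, (inf_mem_iff_of_isMaximal hT _ _).2 ⟨hs.1, hψ⟩, fun T' hT' hm => ?_⟩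
    rw [inf_mem_iff_of_isMaximal hT'] at hm
    rw [Finset.coe_insert, Set.insert_subset_iff]
    exact ⟨hm.1, h T' hT' hm.2⟩

/-- The closure of a family of complete theories in the topology with basic open sets
`{T | φ ∈ T}`. -/
def theoryClosure (𝒯 : Set L.Theory) : Set L.Theory :=
  {T | T.IsMaximal ∧ ∀ φ ∈ T, ∃ T' ∈ 𝒯, φ ∈ T'}

theorem isFamily_theoryClosure (𝒯 : Set L.Theory) : IsFamily (theoryClosure 𝒯) :=
  fun _ hT => hT.1

theorem subset_theoryClosure {𝒯 : Set L.Theory} (h : IsFamily 𝒯) : 𝒯 ⊆ theoryClosure 𝒯 :=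
  fun T hT => ⟨h T hT, fun _ hφ => ⟨T, hT, hφ⟩⟩

theorem theoryClosure_theoryClosure (𝒯 : Set L.Theory) :
    theoryClosure (theoryClosure 𝒯) = theoryClosure 𝒯 := by
  refine Set.Subset.antisymm (fun T hT => ⟨hT.1, fun φ hφ => ?_⟩)
    (subset_theoryClosure (isFamily_theoryClosure 𝒯))
  obtain ⟨T', hT', h⟩ := hT.2 φ hφ
  exact hT'.2 φ h

end Maximal

/-! ### The `E`-closure as a topological closure -/

section Closure

variable {L : FirstOrder.Language.{u, v}} [L.IsRelational]

/-- A component of an `E`-union is isomorphic to the `E`-class of any of its elements. -/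
noncomputable def eClassEquiv (hpos : IsEmpty (L.Relations 0)) {I : Type w} (A : I → Type w')
    [∀ i, L.Structure (A i)] (i : I) (a : A i) :
    A i ≃[L] eClass L (B := EComb A) ⟨i, a⟩ where
  toEquiv := Equiv.ofBijective (fun y => ⟨⟨i, y⟩, rfl⟩) ⟨fun y z h => by
    exact eq_of_heq (Sigma.mk.inj (congrArg Subtype.val h)).2, fun ⟨⟨j, z⟩, h⟩ => by
    obtain rfl : i = j := h
    exact ⟨z, rfl⟩⟩
  map_fun' f := isEmptyElim f
  map_rel' {n} R x := by
    change (∃ (j : I) (y : Fin n → A j), (∀ k, (⟨i, x k⟩ : Σ i, A i) = ⟨j, y k⟩) ∧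
      FirstOrder.Language.Structure.RelMap R y) ↔ _
    refine ⟨fun ⟨j, y, hy, hR⟩ => ?_, fun h => ⟨i, x, fun _ => rfl, h⟩⟩
    -- With no arguments nothing would force `j = i`: a nullary predicate true in one component
    -- would hold in the whole union.
    rcases n with _ | n
    · exact hpos.elim R
    · obtain rfl : i = j := congrArg Sigma.fst (hy 0)
      obtain rfl : x = y := funext fun k => eq_of_heq (Sigma.mk.inj (hy k)).2
      exact hR

theorem completeTheory_eClass_eComb (hpos : IsEmpty (L.Relations 0)) {I : Type w}
    (A : I → Type w') [∀ i, L.Structure (A i)] (b : EComb A) :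
    L.completeTheory (eClass L b) = L.completeTheory (A b.1) := by
  obtain ⟨i, a⟩ := b
  exact (StrongHomClass.elementarilyEquivalent (eClassEquiv hpos A i a)).completeTheory_eq.symm

/-- Elementary equivalence to an `E`-union makes `E` reflexive. -/
theorem self_mem_eClass {I : Type w} {A : I → Type w'} [∀ i, L.Structure (A i)]
    {B : Type*} [L.Structure B] [eqvLanguage.Structure B]
    (h : (L.sum eqvLanguage).ElementarilyEquivalent B (EComb A)) (b : B) : b ∈ eClass L b := by
  let χ : (L.sum eqvLanguage).Sentence := .all (.rel
    (Sum.inr EqvSymbol.E : (L.sum eqvLanguage).Relations 2)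
    ![.var (.inr (Fin.last 0)), .var (.inr (Fin.last 0))])
  have hA : EComb A ⊨ χ := fun x => rfl
  have hB : B ⊨ χ := (elementarilyEquivalent_iff.1 h χ).2 hA
  have := hB b
  change FirstOrder.Language.Structure.RelMap (L := eqvLanguage) EqvSymbol.E ![b, b]
  refine (iff_of_eq (congrArg (FirstOrder.Language.Structure.RelMap (L := eqvLanguage)
    EqvSymbol.E) ?_)).1 this
  funext i
  fin_cases i <;> rfl

/-- That some class satisfies `φ` is a first-order sentence, so it transfers from `B` to the union,
whose classes are the components. -/
theorem clE_subset_theoryClosure (hpos : IsEmpty (L.Relations 0)) (𝒯 : Set L.Theory) :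
    ClE 𝒯 ⊆ theoryClosure 𝒯 := by
  rintro _ ⟨I, A, _, B, _, _, _, hA, hB, b, rfl⟩
  have : Nonempty (eClass L b) := ⟨⟨b, self_mem_eClass hB b⟩⟩
  refine ⟨completeTheory.isMaximal L _, fun φ hφ => ?_⟩
  have h : B ⊨ exSentence (relativize φ) :=
    (realize_exSentence _).2 ⟨b, (realize_relativize_sentence b φ).2 hφ⟩
  obtain ⟨c, hc⟩ := (realize_exSentence _).1 ((elementarilyEquivalent_iff.1 hB _).1 h)
  refine ⟨_, hA c.1, ?_⟩
  rw [← completeTheory_eClass_eComb hpos A c]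
  exact (realize_relativize_sentence c φ).1 hc

/-- Take the union of one model per member of `𝒯`. Each finite part of `T` holds in some component,
so compactness gives an element whose class satisfies all of `T`. -/
theorem theoryClosure_subset_clE (hpos : IsEmpty (L.Relations 0)) {𝒯 : Set L.Theory}
    (h𝒯 : IsFamily 𝒯) : theoryClosure 𝒯 ⊆ ClE 𝒯 := by
  classical
  rintro T ⟨hT, hcl⟩
  have hmod : ∀ i : 𝒯, ∃ (A : Type (max u v)) (_ : L.Structure A), Nonempty A ∧
      L.completeTheory A = i.1 := fun i => by
    obtain ⟨M⟩ := (h𝒯 i i.2).1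
    exact ⟨M, inferInstance, inferInstance, (eq_of_isMaximal_of_subset (h𝒯 i i.2)
      (completeTheory.isMaximal L M) Theory.completeTheory.subset).symm⟩
  choose A hstr hne hth using hmod
  obtain ⟨B, SB, hB, b, hb⟩ := exists_elementarilyEquivalent_realize (L := L.sum eqvLanguage)
    (M := EComb A) (Γ := relativize '' T) fun s hs => by
      obtain ⟨s', hs', rfl⟩ := Finset.subset_set_image_iff.1 hs
      obtain ⟨ψ, hψ, hsub⟩ := exists_mem_forall_subset hT s' hs'
      obtain ⟨T', hT', hψ'⟩ := hcl ψ hψ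
      obtain ⟨a⟩ := hne ⟨T', hT'⟩
      let c : EComb A := ⟨⟨T', hT'⟩, a⟩
      refine ⟨c, fun φ hφ => ?_⟩
      obtain ⟨φ, hφs, rfl⟩ := Finset.mem_image.1 hφ
      refine (realize_relativize_sentence c φ).2 ?_
      rw [← mem_completeTheory, completeTheory_eClass_eComb hpos, hth]
      exact hsub T' (h𝒯 T' hT') hψ' hφs
  let : L.Structure B := (LHom.sumInl : L →ᴸ L.sum eqvLanguage).reduct B
  let : eqvLanguage.Structure B := (LHom.sumInr : eqvLanguage →ᴸ L.sum eqvLanguage).reduct B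
  rw [← sumStructure_reduct SB] at hB hb
  refine ⟨𝒯, A, hstr, B, inferInstance, inferInstance, hne, fun i => hth i ▸ i.2, hB, b, ?_⟩
  have : Nonempty (eClass L b) := ⟨⟨b, self_mem_eClass hB b⟩⟩
  refine eq_of_isMaximal_of_subset hT (completeTheory.isMaximal L _) fun φ hφ => ?_
  exact (realize_relativize_sentence b φ).1 (hb _ ⟨φ, hφ, rfl⟩)

theorem clE_eq_theoryClosure (hpos : IsEmpty (L.Relations 0)) {𝒯 : Set L.Theory}
    (h𝒯 : IsFamily 𝒯) : ClE 𝒯 = theoryClosure 𝒯 :=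
  (clE_subset_theoryClosure hpos 𝒯).antisymm (theoryClosure_subset_clE hpos h𝒯)

end Closure

/-! ### Theories of one-element structures -/

section OneElement

variable {L : FirstOrder.Language.{u, v}} [L.IsRelational]

/-- The one-element structure in which exactly the predicates in `S` hold. -/
@[reducible] def pointStructure (S : Set (Σ n, L.Relations n)) : L.Structure PUnit.{1} where
  funMap f := isEmptyElim f
  RelMap {n} R _ := (⟨n, R⟩ : Σ n, L.Relations n) ∈ S

/-- The theory of the one-element structure in which exactly the predicates in `S` hold. -/
def pointTheory (S : Set (Σ n, L.Relations n)) : L.Theory :=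
  @completeTheory L PUnit.{1} (pointStructure S)

theorem isMaximal_pointTheory (S : Set (Σ n, L.Relations n)) : (pointTheory S).IsMaximal :=
  let := pointStructure S
  completeTheory.isMaximal L PUnit.{1}

theorem emptySentence_mem_pointTheory (S : Set (Σ n, L.Relations n)) (R : Σ n, L.Relations n) :
    emptySentence R.2 ∈ pointTheory S ↔ R ∉ S := by
  let := pointStructure S
  change PUnit.{1} ⊨ emptySentence R.2 ↔ _
  rw [emptySentence, Sentence.Realize, BoundedFormula.realize_alls]
  exact ⟨fun h => h default, fun h _ => h⟩

/-- On one point quantifiers and equality are trivial, so only the predicates occurring in `φ`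
matter. -/
theorem exists_finite_realize_iff {n : ℕ} (φ : L.BoundedFormula Empty n) :
    ∃ F : Set (Σ n, L.Relations n), F.Finite ∧ ∀ S S' : Set (Σ n, L.Relations n),
      (∀ R ∈ F, R ∈ S ↔ R ∈ S') → ∀ (e : Empty → PUnit.{1}) (xs : Fin n → PUnit.{1}),
        (@BoundedFormula.Realize L PUnit.{1} (pointStructure S) _ _ φ e xs ↔
          @BoundedFormula.Realize L PUnit.{1} (pointStructure S') _ _ φ e xs) := by
  induction φ with
  | falsum => exact ⟨∅, Set.finite_empty, fun _ _ _ _ _ => Iff.rfl⟩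
  | equal t₁ t₂ =>
    exact ⟨∅, Set.finite_empty, fun _ _ _ _ _ =>
      iff_of_true (Subsingleton.elim _ _) (Subsingleton.elim _ _)⟩
  | rel R ts =>
    exact ⟨{⟨_, R⟩}, Set.finite_singleton _, fun S S' h _ _ => h _ rfl⟩
  | imp φ ψ ihφ ihψ =>
    obtain ⟨F, hF, h⟩ := ihφ
    obtain ⟨F', hF', h'⟩ := ihψ
    refine ⟨F ∪ F', hF.union hF', fun S S' hS e xs => ?_⟩
    simp only [BoundedFormula.Realize]
    exact imp_congr (h S S' (fun R hR => hS R (Or.inl hR)) e xs)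
      (h' S S' (fun R hR => hS R (Or.inr hR)) e xs)
  | all φ ih =>
    obtain ⟨F, hF, h⟩ := ih
    refine ⟨F, hF, fun S S' hS e xs => ?_⟩
    simp only [BoundedFormula.Realize]
    exact forall_congr' fun x => h S S' hS e _

/-- Given an infinite set `P` of predicates, every sentence in the theory of a one-element structure
belongs to the theory of another one, that differs from the first in a single predicate from `P`,
not from a given finite set. -/
theorem exists_pointTheory_ne {P : Set (Σ n, L.Relations n)} (hP : P.Infinite)
    {S : Set (Σ n, L.Relations n)} (hS : S ⊆ P) {φ : L.Sentence} (hφ : φ ∈ pointTheory S) :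
    ∃ S' ⊆ P, φ ∈ pointTheory S' ∧ pointTheory S' ≠ pointTheory S := by
  obtain ⟨F, hF, h⟩ := exists_finite_realize_iff φ
  obtain ⟨R, hRP, hRF⟩ := hP.exists_notMem_finite hF
  have key : ∀ S' : Set (Σ n, L.Relations n), (∀ Q, Q ≠ R → (Q ∈ S ↔ Q ∈ S')) →
      φ ∈ pointTheory S' := fun S' hS' =>
    (h S S' (fun Q hQ => hS' Q fun hQR => hRF (hQR ▸ hQ)) _ _).1 hφ
  have hne : ∀ S' : Set (Σ n, L.Relations n), ¬ (R ∈ S' ↔ R ∈ S) →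
      pointTheory S' ≠ pointTheory S := fun S' hS' heq => hS' <| by
    rw [← not_iff_not, ← emptySentence_mem_pointTheory, heq, emptySentence_mem_pointTheory]
  -- Toggle `R`: `φ` cannot see the change, but the sentence saying that `R` is empty does.
  by_cases hRS : R ∈ S
  · exact ⟨S \ {R}, Set.sdiff_subset.trans hS, key _ fun Q hQ => by simp [hQ],
      hne _ (by simp [hRS])⟩
  · exact ⟨insert R S, Set.insert_subset hRP hS, key _ fun Q hQ => by simp [hQ],
      hne _ (by simp [hRS])⟩

end OneElement

/-- A family with a nonempty relatively open subset of non-isolated theories has no least generating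
set. -/
theorem not_exists_isLeastGenerating {L : FirstOrder.Language.{u, v}} [L.IsRelational]
    (hpos : IsEmpty (L.Relations 0)) {𝒯 : Set L.Theory} (hfam : IsFamily 𝒯)
    (hcl : theoryClosure 𝒯 = 𝒯) (χ : L.Sentence) (hne : ∃ T ∈ 𝒯, χ ∈ T)
    (hacc : ∀ T ∈ 𝒯, χ ∈ T → T ∈ theoryClosure (𝒯 \ {T})) :
    ¬ ∃ 𝒮 : Set L.Theory, IsLeastGenerating 𝒮 𝒯 := by
  rintro ⟨𝒮, ⟨⟨h𝒮, hgen⟩, -⟩, hleast⟩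
  obtain ⟨T, hT, hχ⟩ := hne
  obtain ⟨T', hT', hχ'⟩ := (clE_subset_theoryClosure hpos 𝒮 (hgen.symm ▸ hT)).2 χ hχ
  have hfam' : IsFamily (𝒯 \ {T'}) := fun T hT => hfam T hT.1
  refine (hleast (𝒯 \ {T'}) ⟨Set.sdiff_subset, ?_⟩ hT').2 rfl
  rw [clE_eq_theoryClosure hpos hfam']
  refine Set.Subset.antisymm (fun T h => ?_) fun T h => ?_
  · rw [← hcl]
    exact ⟨h.1, fun φ hφ => (h.2 φ hφ).imp fun _ h => ⟨h.1.1, h.2⟩⟩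
  · by_cases hTT' : T = T'
    · exact hTT' ▸ hacc T' (h𝒮 hT') hχ'
    · exact subset_theoryClosure hfam' ⟨h, hTT'⟩

end EClosure

theorem proposition3p7 (L : FirstOrder.Language.{u, v}) [L.IsRelational]
    (hpos : IsEmpty (L.Relations 0))
    (𝒯₀ : Set L.Theory) (hfam : EClosure.IsFamily 𝒯₀)
    (hempty : {R : Σ n, L.Relations n |
      ∀ T ∈ 𝒯₀, EClosure.emptySentence R.2 ∈ T}.Infinite) :
    ∃ 𝒯₀' : Set L.Theory, EClosure.IsFamily 𝒯₀' ∧ 𝒯₀ ⊆ 𝒯₀' ∧ EClosure.IsEClosed 𝒯₀' ∧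
      ¬ ∃ 𝒮 : Set L.Theory, EClosure.IsLeastGenerating 𝒮 𝒯₀' := by
  classical
  let P : Set (Σ n, L.Relations n) := {R | ∀ T ∈ 𝒯₀, EClosure.emptySentence R.2 ∈ T}
  let 𝒟 : Set L.Theory := EClosure.pointTheory '' P.powerset
  have hfam' : EClosure.IsFamily (𝒯₀ ∪ 𝒟) := by
    rintro T (hT | ⟨S, -, rfl⟩)
    · exact hfam T hT
    · exact EClosure.isMaximal_pointTheory S
  have hsub := EClosure.subset_theoryClosure hfam'
  have hcl := EClosure.theoryClosure_theoryClosure (𝒯₀ ∪ 𝒟)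
  have hmax := EClosure.isFamily_theoryClosure (𝒯₀ ∪ 𝒟)
  obtain ⟨R, hR⟩ := hempty.nonempty
  refine ⟨EClosure.theoryClosure (𝒯₀ ∪ 𝒟), hmax, Set.subset_union_left.trans hsub,
    (EClosure.clE_eq_theoryClosure hpos hmax).trans hcl,
    EClosure.not_exists_isLeastGenerating hpos hmax hcl (EClosure.emptySentence R.2).not ?_ ?_⟩
  · refine ⟨_, hsub (Or.inr ⟨P, Set.mem_powerset subset_rfl, rfl⟩), ?_⟩
    rw [EClosure.not_mem_iff_of_isMaximal (EClosure.isMaximal_pointTheory P),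
      EClosure.emptySentence_mem_pointTheory]
    exact not_not_intro hR
  · intro T hT hRT
    refine ⟨hmax T hT, fun φ hφ => ?_⟩
    -- Approximating `T` on the conjunction of `φ` with "`R` is nonempty" keeps `T'` out of `𝒯₀`.
    obtain ⟨T', hT', hφ'⟩ := hT.2 _ ((EClosure.inf_mem_iff_of_isMaximal (hmax T hT) _ _).2
      ⟨hφ, hRT⟩)
    rw [EClosure.inf_mem_iff_of_isMaximal (hfam' T' hT'),
      EClosure.not_mem_iff_of_isMaximal (hfam' T' hT')] at hφ'
    -- If `T' = T`, then `T` is itself a one-point theory, and toggling a predicate gives a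
    -- different one containing `φ`.
    by_cases hTT' : T' = T
    · subst hTT'
      rcases hT' with hT' | ⟨S, hS, rfl⟩
      · exact absurd (hR T' hT') hφ'.2
      · obtain ⟨S', hS', hφS', hne⟩ := EClosure.exists_pointTheory_ne hempty hS hφ
        exact ⟨_, ⟨hsub (Or.inr ⟨S', hS', rfl⟩), hne⟩, hφS'⟩
    · exact ⟨T', ⟨hsub hT', hTT'⟩, hφ'.1⟩
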